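/- Let $G=(V,E,c)$ be a finite simple directed graph (no loops, and at most one directed edge between any two vertices) with a surjective labeling $c\colon E\to\mathcal C$ onto a set of labels. Let $\mathrm{Lie}(G)=\mathfrak g_{-2}\oplus\mathfrak g_{-1}$ be the associated real graph Lie algebra: $\mathfrak g_{-1}$ has basis $V$, $\mathfrak g_{-2}$ has basis $\mathcal C$, and the bracket is given by $[x,y]=c(\overrightarrow{xy})$ if $\overrightarrow{xy}\in E$, $[x,y]=-c(\overrightarrow{yx})$ if $\overrightarrow{yx}\in E$, $[x,y]=0$ for all other $x,y\in V$, and $[\mathfrak g_{-2},\mathrm{Lie}(G)]=0$. The degree $\deg(v)$ of a vertex $v$ is the number of vertices joined to $v$ by an edge of either direction. Put $\mathfrak g_p=0$ for $p\le -3$. The Tanaka prolongation of $\mathrm{Lie}(G)$ is $\mathrm{Lie}(G)\oplus\bigoplus_{k\ge 0}\mathfrak g_k$, where, inductively, $\mathfrak g_k$ is the space of linear maps $\varphi\colon\mathrm{Lie}(G)\to\mathrm{Lie}(G)\oplus\bigoplus_{0\le j<k}\mathfrak g_j$ with $\varphi(\mathfrak g_p)\subseteq\mathfrak g_{p+k}$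 for $p<0$ and $\varphi([x,y])=[\varphi(x),y]+[x,\varphi(y)]$ for all $x,y\in\mathrm{Lie}(G)$; here $[\psi,x]=-[x,\psi]=\psi(x)$ for $\psi\in\mathfrak g_j$, $j\ge 0$, $x\in\mathrm{Lie}(G)$. The Lie algebra $\mathrm{Lie}(G)$ is said to be of infinite type if its Tanaka prolongation is infinite-dimensional. Assume that every edge of $G$ carries its own label, that is, $c$ is injective. Then $$\dim(\ker \mathrm{ad}_v\cap\mathfrak g_{-1})=|V|-\deg(v)\qquad\text{for every vertex } v\in V.$$ Moreover, if $G$ has a vertex of degree one, then $\mathrm{Lie}(G)$ is of infinite type; and if $G$ has no isolated vertices (vertices of degree zero), then $\mathrm{Lie}(G)$ is of infinite type if and only if $G$ has a vertex of degree one. -/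

import Mathlib

noncomputable section

/-! ### The Tanaka prolongation of a negatively graded Lie algebra -/

namespace Tanaka

universe u

/-- A truncated prolongation `P = 𝔤 ⊕ 𝔤₀ ⊕ ⋯ ⊕ 𝔤ₖ₋₁` of a Lie algebra `L = 𝔤`, together with its
homogeneous components `deg p` (for `p : ℤ`) and the bracket `act u x = [u, x]` of an element
`u` of `P` with an element `x` of `𝔤`. -/
structure Stage (K : Type*) (L : Type u) [Field K] [LieRing L] [LieAlgebra K L] where
  carrier : Type u
  [addCommGroup : AddCommGroup carrier]
  [module : Module K carrier]
  deg : ℤ → Submodule K carrier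
  act : carrier →ₗ[K] L →ₗ[K] carrier

attribute [instance] Stage.addCommGroup Stage.module

variable {K : Type*} {L : Type u} [Field K] [LieRing L] [LieAlgebra K L]

/-- The linear maps `φ : 𝔤 → P` that are homogeneous of degree `k` and satisfy the Leibniz rule
`φ [x, y] = [φ x, y] + [x, φ y]`, where `[x, φ y] = -[φ y, x]`. -/
def Stage.derivations (gr : ℤ → Submodule K L) (P : Stage K L) (k : ℕ) :
    Submodule K (L →ₗ[K] P.carrier) where
  carrier := {φ | (∀ p : ℤ, ∀ x ∈ gr p, φ x ∈ P.deg (p + k)) ∧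
    ∀ x y : L, φ ⁅x, y⁆ = P.act (φ x) y - P.act (φ y) x}
  add_mem' := by
    rintro φ ψ ⟨h1, h2⟩ ⟨h3, h4⟩
    refine ⟨fun p x hx => add_mem (h1 p x hx) (h3 p x hx), fun x y => ?_⟩
    simp only [LinearMap.add_apply, map_add, h2 x y, h4 x y]
    abel
  zero_mem' := ⟨fun p x _ => by simp, fun x y => by simp⟩
  smul_mem' := by
    rintro c φ ⟨h1, h2⟩
    refine ⟨fun p x hx => Submodule.smul_mem _ c (h1 p x hx), fun x y => ?_⟩
    simp only [LinearMap.smul_apply, map_smul, h2 x y, smul_sub]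

/-- Adjoin to `P = 𝔤 ⊕ 𝔤₀ ⊕ ⋯ ⊕ 𝔤ₖ₋₁` the component `𝔤ₖ` of degree `k`, with `[φ, x] = φ x`
for `φ` in `𝔤ₖ` and `x` in `𝔤`. -/
def Stage.next (gr : ℤ → Submodule K L) (P : Stage K L) (k : ℕ) : Stage K L where
  carrier := P.carrier × P.derivations gr k
  deg p := if p = k then LinearMap.range (LinearMap.inr K P.carrier (P.derivations gr k))
    else (P.deg p).map (LinearMap.inl K P.carrier (P.derivations gr k))
  act := (P.act ∘ₗ LinearMap.fst K P.carrier (P.derivations gr k) +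
      (P.derivations gr k).subtype ∘ₗ LinearMap.snd K P.carrier (P.derivations gr k)).compr₂
    (LinearMap.inl K P.carrier (P.derivations gr k))

/-- `stage gr k` is `𝔤 ⊕ 𝔤₀ ⊕ ⋯ ⊕ 𝔤ₖ₋₁`; in particular `stage gr 0` is `𝔤` itself. -/
def stage (gr : ℤ → Submodule K L) : ℕ → Stage K L
  | 0 =>
    { carrier := L
      deg := gr
      act := LinearMap.mk₂ K (fun u x => ⁅u, x⁆) add_lie smul_lie lie_add (fun c u x => lie_smul c u x) }
  | k + 1 => (stage gr k).next gr k

/-- The component `𝔤ₖ` of degree `k ≥ 0` of the Tanaka prolongation of `𝔤 = ⨁_{p < 0} gr p`. -/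
abbrev component (gr : ℤ → Submodule K L) (k : ℕ) :
    Submodule K (L →ₗ[K] (stage gr k).carrier) :=
  (stage gr k).derivations gr k

open scoped DirectSum in
/-- The (underlying vector space of the) Tanaka prolongation `𝔤 ⊕ ⨁_{k ≥ 0} 𝔤ₖ` of the
negatively graded Lie algebra `𝔤 = ⨁_{p < 0} gr p`. -/
abbrev Prolongation (gr : ℤ → Submodule K L) : Type _ :=
  L × ⨁ k : ℕ, component gr k

/-- A negatively graded Lie algebra is of infinite type if its Tanaka prolongation is
infinite-dimensional. -/
def InfiniteType (gr : ℤ → Submodule K L) : Prop :=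
  ¬ FiniteDimensional K (Prolongation gr)

end Tanaka

/-! ### Graph Lie algebras -/

/-- A labeled simple directed graph on the vertex set `V`: there are no loops, any two vertices
are joined by at most one directed edge (both are contained in `asymm`), and the labeling of the
directed edges by elements of `C` is surjective. -/
structure LabeledDigraph (V C : Type*) extends Digraph V where
  asymm : ∀ v w : V, Adj v w → ¬ Adj w v
  label : {e : V × V // Adj e.1 e.2} → C
  label_surjective : Function.Surjective label

namespace LabeledDigraph

variable {V C : Type*}

/-- Every edge has its own label. -/
def UniquelyLabeled (G : LabeledDigraph V C) : Prop := Function.Injective G.label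

/-- The degree of a vertex: the number of its neighbours, regardless of orientation. -/
def degree (G : LabeledDigraph V C) (v : V) : ℕ := {w : V | G.Adj v w ∨ G.Adj w v}.ncard

open Classical in
/-- The bracket `[v, w]` of two vertices, a vector of the space with basis `C`. -/
def vertexBracket (G : LabeledDigraph V C) (v w : V) : C → ℝ :=
  if h : G.Adj v w then Pi.single (G.label ⟨(v, w), h⟩) 1
  else if h : G.Adj w v then -Pi.single (G.label ⟨(w, v), h⟩) 1
  else 0

theorem vertexBracket_swap (G : LabeledDigraph V C) (v w : V) :
    G.vertexBracket v w = -G.vertexBracket w v := by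
  unfold vertexBracket
  by_cases h : G.Adj v w
  · simp [h, G.asymm v w h]
  · by_cases h' : G.Adj w v <;> simp [h, h']

/-- The real vector space with basis `V ⊔ C` (for finite `V` and `C`) underlying the graph Lie
algebra of `G`. -/
def LieAlg (_G : LabeledDigraph V C) : Type _ := (V → ℝ) × (C → ℝ)

namespace LieAlg

variable (G : LabeledDigraph V C)

instance : AddCommGroup G.LieAlg := inferInstanceAs (AddCommGroup ((V → ℝ) × (C → ℝ)))

instance : Module ℝ G.LieAlg := inferInstanceAs (Module ℝ ((V → ℝ) × (C → ℝ)))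

open Classical in
/-- The basis vector given by a vertex. -/
def vertex (v : V) : G.LieAlg := (Pi.single v 1, 0)

/-- The grading `𝔤₋₁ = span V`, `𝔤₋₂ = span C`. -/
def grading (p : ℤ) : Submodule ℝ G.LieAlg :=
  if p = -1 then LinearMap.range (LinearMap.inl ℝ (V → ℝ) (C → ℝ))
  else if p = -2 then LinearMap.range (LinearMap.inr ℝ (V → ℝ) (C → ℝ))
  else ⊥

variable [Fintype V]

/-- The bilinear extension of the bracket of vertices; the span of `C` is central. -/
instance : Bracket G.LieAlg G.LieAlg where
  bracket x y := (0, ∑ v, ∑ w, (x.1 v * y.1 w) • G.vertexBracket v w)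

theorem bracket_def (x y : G.LieAlg) :
    ⁅x, y⁆ = ((0, ∑ v, ∑ w, (x.1 v * y.1 w) • G.vertexBracket v w) : (V → ℝ) × (C → ℝ)) :=
  rfl

instance : LieRing G.LieAlg where
  add_lie x y z := by
    refine Prod.ext (add_zero (0 : V → ℝ)).symm ?_
    change ∑ v, ∑ w, ((x.1 v + y.1 v) * z.1 w) • G.vertexBracket v w =
      ∑ v, ∑ w, (x.1 v * z.1 w) • G.vertexBracket v w +
        ∑ v, ∑ w, (y.1 v * z.1 w) • G.vertexBracket v w
    simp only [add_mul, add_smul, Finset.sum_add_distrib]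
  lie_add x y z := by
    refine Prod.ext (add_zero (0 : V → ℝ)).symm ?_
    change ∑ v, ∑ w, (x.1 v * (y.1 w + z.1 w)) • G.vertexBracket v w =
      ∑ v, ∑ w, (x.1 v * y.1 w) • G.vertexBracket v w +
        ∑ v, ∑ w, (x.1 v * z.1 w) • G.vertexBracket v w
    simp only [mul_add, add_smul, Finset.sum_add_distrib]
  lie_self x := by
    refine Prod.ext rfl ?_
    change ∑ v, ∑ w, (x.1 v * x.1 w) • G.vertexBracket v w = 0
    have h : ∑ v, ∑ w, (x.1 v * x.1 w) • G.vertexBracket v w =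
        -∑ v, ∑ w, (x.1 v * x.1 w) • G.vertexBracket v w := by
      conv_lhs => rw [Finset.sum_comm]
      simp only [← Finset.sum_neg_distrib]
      refine Finset.sum_congr rfl fun v _ => Finset.sum_congr rfl fun w _ => ?_
      rw [G.vertexBracket_swap w v, smul_neg, mul_comm]
    exact self_eq_neg.mp h
  leibniz_lie x y z := by
    simp only [bracket_def]
    refine Prod.ext (add_zero (0 : V → ℝ)).symm ?_
    change ∑ v, ∑ w, (x.1 v * (0 : ℝ)) • G.vertexBracket v w =
      ∑ v, ∑ w, ((0 : ℝ) * z.1 w) • G.vertexBracket v w +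
        ∑ v, ∑ w, (y.1 v * (0 : ℝ)) • G.vertexBracket v w
    simp

instance : LieAlgebra ℝ G.LieAlg where
  lie_smul t x y := by
    refine Prod.ext (smul_zero t).symm ?_
    change ∑ v, ∑ w, (x.1 v * (t * y.1 w)) • G.vertexBracket v w =
      t • ∑ v, ∑ w, (x.1 v * y.1 w) • G.vertexBracket v w
    simp only [Finset.smul_sum, smul_smul]
    refine Finset.sum_congr rfl fun v _ => Finset.sum_congr rfl fun w _ => ?_
    rw [mul_left_comm]

end LieAlg

end LabeledDigraph

end

/-!
Let every edge of `G` carry its own label. Then the coordinate of `[x, v]` at the label of an edge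
`ab` is, up to sign, the coordinate of `x` at `a` if `v = b`, its coordinate at `b` if `v = a`, and
zero for all other vertices `v`. Hence `x ∈ 𝔤₋₁` commutes with `v` exactly when its coordinates at
the neighbours of `v` vanish, which gives the dimension formula.

If `v` has a single neighbour `w`, then `ad v` has rank one on `𝔤₋₁`, and with the coordinate `ω`
at `w` the maps `φ₀ = ω ⊗ v` and `φₖ₊₁ = ω ⊗ φₖ` are nonzero elements of all components of the
prolongation (`Tanaka.infiniteType_of_rank_one`).

Suppose now that all degrees are at least two. The Lie algebra acts from the right on the stages of
the prolongation, hence from the left on functionals on them (`Tanaka.coaction`). Write `h_e` and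
`f_a` for the coordinates at a label and at a vertex, as functionals on the prolongation that
vanish on all components of nonnegative degree. For an edge `e = ab`, suitably oriented,
`b • h_e = f_a`, `a • h_e = -f_b`, and `c • h_e = 0` for the other vertices `c`. If `c ≠ b`, choose
an edge `bd` with `d ≠ c`; then `c² • f_b = ± c² d • h_bd = 0`, because `c` kills `h_bd` and the
commutator of `c` and `d` is central. So the cube of every vertex kills every `h_e`
(`UniquelyLabeled.coaction_vertex_cube`).

Finitely many operators whose commutators are central and which are nilpotent at a vector are
jointly nilpotent there (`Module.End.exists_mem_wordKernel`): the Heisenberg relation makes the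
commutators nilpotent at the vector, and on the common kernel of the commutators one is left with
commuting nilpotent operators. Hence all long words in the vertices kill all `h_e`. An element of
degree `k` is determined by the values of the `h_e` after `k + 2` brackets with vertices, as there
are no isolated vertices; so the components of large degree vanish
(`Tanaka.not_infiniteType_of_coaction_pow_eq_zero`).
-/

/-! ### Locally nilpotent operators with central commutators -/

namespace Module.End

variable {R M : Type*} [Field R] [AddCommGroup M] [Module R M]

/-- The Heisenberg relation `[x, yᵏ⁺¹] = (k + 1) [x, y] yᵏ`, applied to a vector. -/
theorem mul_pow_succ_apply_of_commute_commutator {x y z : Module.End R M}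
    (hz : z = x * y - y * x) (hy : Commute z y) (k : ℕ) (m : M) :
    x ((y ^ (k + 1)) m) = (y ^ (k + 1)) (x m) + ((k + 1 : ℕ) : R) • (y ^ k) (z m) := by
  have key : x * y ^ (k + 1) = y ^ (k + 1) * x + ((k + 1 : ℕ) : R) • (y ^ k * z) := by
    induction k with
    | zero => simp [hz]
    | succ k ih =>
      have h1 : x * y = y * x + z := by rw [hz]; abel
      rw [pow_succ y (k + 1), ← mul_assoc, ih, add_mul, mul_assoc _ x y, h1, smul_mul_assoc,
        mul_assoc _ z y, hy.eq, ← mul_assoc _ y z, ← pow_succ, mul_add, ← mul_assoc,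
        add_assoc, Nat.cast_succ (k + 1), add_smul, one_smul, add_comm (_ * z)]
  simpa using congrArg (fun f : Module.End R M => f m) key

theorem commutator_pow_apply_eq_zero_of_apply_eq_zero [CharZero R] {x y z : Module.End R M}
    (hz : z = x * y - y * x) (hx : Commute z x) (hy : Commute z y) (n : ℕ) (m : M)
    (hxm : x m = 0) (hym : (y ^ n) m = 0) : (z ^ n) m = 0 := by
  induction n generalizing m with
  | zero => simpa using hym
  | succ n ih =>
    have h := mul_pow_succ_apply_of_commute_commutator hz hy n m
    rw [hym, hxm, map_zero, map_zero, zero_add, eq_comm,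
      smul_eq_zero_iff_right (Nat.cast_ne_zero.mpr n.succ_ne_zero)] at h
    rw [pow_succ, Module.End.mul_apply]
    refine ih (z m) ?_ h
    rw [← Module.End.mul_apply, ← hx.eq, Module.End.mul_apply, hxm, map_zero]

/-- If `x` and `y` are nilpotent at a vector and commute with `z = [x, y]`, then `z` is nilpotent
at that vector. -/
theorem exists_commutator_pow_apply_eq_zero [CharZero R] {x y z : Module.End R M}
    (hz : z = x * y - y * x) (hx : Commute z x) (hy : Commute z y) (k n : ℕ) (m : M)
    (hxm : (x ^ k) m = 0) (hym : (y ^ n) m = 0) : ∃ N, (z ^ N) m = 0 := by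
  induction k generalizing m with
  | zero => exact ⟨0, by simpa using hxm⟩
  | succ k ih =>
    -- `xᵏ m` is killed by `x`, and still by a power of `y`.
    have hpow : ∀ j, (y ^ (n + j)) ((x ^ j) m) = 0 := by
      intro j
      induction j with
      | zero => simpa using hym
      | succ j ihj =>
        have h := mul_pow_succ_apply_of_commute_commutator hz hy (n + j) ((x ^ j) m)
        have hy1 : (y ^ (n + j + 1)) ((x ^ j) m) = 0 := by
          rw [pow_succ', Module.End.mul_apply, ihj, map_zero]
        have hz1 : (y ^ (n + j)) (z ((x ^ j) m)) = 0 := by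
          rw [← Module.End.mul_apply, ← (hy.pow_right _).eq, Module.End.mul_apply, ihj, map_zero]
        rw [hy1, hz1, map_zero, smul_zero, add_zero] at h
        rw [pow_succ' x, Module.End.mul_apply, ← add_assoc, ← h]
    have hker : x ((x ^ k) m) = 0 := by
      rwa [← Module.End.mul_apply, ← pow_succ']
    have h1 := commutator_pow_apply_eq_zero_of_apply_eq_zero hz hx hy (n + k) _ hker (hpow k)
    obtain ⟨N, hN⟩ := ih ((z ^ (n + k)) m)
      (by rw [← Module.End.mul_apply, ← (hx.pow_pow (n + k) k).eq, Module.End.mul_apply, h1])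
      (by rw [← Module.End.mul_apply, ← (hy.pow_pow (n + k) n).eq, Module.End.mul_apply, hym,
        map_zero])
    exact ⟨N + (n + k), by rw [pow_add, Module.End.mul_apply, hN]⟩

/-- Operators that commute on an invariant set `p` and are nilpotent at a nonzero vector of `p`
have a common nonzero kernel vector in `p`. -/
theorem exists_ne_zero_forall_apply_eq_zero {ι : Type*} [Finite ι] (T : ι → Module.End R M)
    (p : Set M) (hp : ∀ i, ∀ m ∈ p, T i m ∈ p)
    (hT : ∀ i j, ∀ m ∈ p, T i (T j m) = T j (T i m)) {m : M} (hm : m ∈ p) (hm0 : m ≠ 0)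
    (hnil : ∀ i, ∃ n : ℕ, (T i ^ n) m = 0) : ∃ m' ∈ p, m' ≠ 0 ∧ ∀ i, T i m' = 0 := by
  have hpow : ∀ j (n : ℕ), ∀ m ∈ p, (T j ^ n) m ∈ p := by
    intro j n
    induction n with
    | zero => intro m hm; simpa using hm
    | succ n ih =>
      intro m hm
      rw [pow_succ', Module.End.mul_apply]
      exact hp j _ (ih m hm)
  have hcomm1 : ∀ i j (n : ℕ), ∀ m ∈ p, T i ((T j ^ n) m) = (T j ^ n) (T i m) := by
    intro i j n
    induction n with
    | zero => intro m _; simp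
    | succ n ih =>
      intro m hm
      rw [pow_succ', Module.End.mul_apply, hT i j _ (hpow j n m hm), ih m hm,
        Module.End.mul_apply]
  have hcomm : ∀ i j (k n : ℕ), ∀ m ∈ p, (T i ^ k) ((T j ^ n) m) = (T j ^ n) ((T i ^ k) m) := by
    intro i j k n
    induction k with
    | zero => intro m _; simp
    | succ k ih =>
      intro m hm
      rw [pow_succ', Module.End.mul_apply, ih m hm, hcomm1 i j n _ (hpow i k m hm),
        Module.End.mul_apply]
  have key : ∀ s : Set ι, s.Finite → ∃ m' ∈ p, m' ≠ 0 ∧ (∀ i ∈ s, T i m' = 0) ∧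
      ∀ i, ∃ n : ℕ, (T i ^ n) m' = 0 := by
    intro s hs
    induction s, hs using Set.Finite.induction_on with
    | empty => exact ⟨m, hm, hm0, by simp, hnil⟩
    | @insert j s _ _ ih =>
      obtain ⟨m', hm', hm0', hker, hnil'⟩ := ih
      classical
      -- Replace `m'` by the last nonzero vector among its images under the powers of `T j`.
      obtain ⟨n, hn⟩ : ∃ n, Nat.find (hnil' j) = n + 1 := by
        refine Nat.exists_eq_succ_of_ne_zero fun h => hm0' ?_
        have h0 := Nat.find_spec (hnil' j)
        rw [h] at h0
        simpa using h0
      refine ⟨(T j ^ n) m', hpow j n m' hm', Nat.find_min (hnil' j) (by omega), ?_, ?_⟩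
      · intro i hi
        rcases Set.mem_insert_iff.mp hi with rfl | hi
        · have h0 := Nat.find_spec (hnil' i)
          rwa [hn, pow_succ', Module.End.mul_apply] at h0
        · rw [hcomm1 i j n m' hm', hker i hi, map_zero]
      · intro i
        obtain ⟨k, hk⟩ := hnil' i
        exact ⟨k, by rw [hcomm i j k n m' hm', hk, map_zero]⟩
  obtain ⟨m', h1, h2, h3, -⟩ := key Set.univ Set.finite_univ
  exact ⟨m', h1, h2, fun i => h3 i trivial⟩

/-- Finitely many operators with central commutators and without a common nonzero kernel vector
are simultaneously nilpotent only at `0`. -/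
theorem eq_zero_of_forall_exists_pow_apply_eq_zero [CharZero R] {ι : Type*} [Finite ι]
    (X : ι → Module.End R M) (hX : ∀ a b c, Commute (X a * X b - X b * X a) (X c))
    (hker : ∀ m, (∀ i, X i m = 0) → m = 0) {m : M} (hm : ∀ i, ∃ n : ℕ, (X i ^ n) m = 0) :
    m = 0 := by
  by_contra hm0
  have hZ : ∀ a b c d, Commute (X a * X b - X b * X a) (X c * X d - X d * X c) :=
    fun a b c d => ((hX a b c).mul_right (hX a b d)).sub_right
      ((hX a b d).mul_right (hX a b c))
  -- First a vector at which all commutators vanish and the operators are still nilpotent.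
  obtain ⟨m₁, hnil₁, hm₁, hZ₁⟩ := exists_ne_zero_forall_apply_eq_zero
    (fun ab : ι × ι => X ab.1 * X ab.2 - X ab.2 * X ab.1)
    {m | ∀ i, ∃ n : ℕ, (X i ^ n) m = 0}
    (fun ab m hm i => by
      obtain ⟨n, hn⟩ := hm i
      refine ⟨n, ?_⟩
      rw [← Module.End.mul_apply, ← ((hX ab.1 ab.2 i).pow_right n).eq, Module.End.mul_apply, hn,
        map_zero])
    (fun ab cd m _ => LinearMap.congr_fun (hZ ab.1 ab.2 cd.1 cd.2).eq m) hm hm0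
    (fun ab => by
      obtain ⟨k, hk⟩ := hm ab.1
      obtain ⟨n, hn⟩ := hm ab.2
      exact exists_commutator_pow_apply_eq_zero rfl (hX _ _ _) (hX _ _ _) k n m hk hn)
  -- On the common kernel of the commutators, the operators commute.
  obtain ⟨m₂, -, hm₂, h₂⟩ := exists_ne_zero_forall_apply_eq_zero X
    {m | ∀ a b, (X a * X b - X b * X a) m = 0}
    (fun c m hm a b => by
      rw [← Module.End.mul_apply, (hX a b c).eq, Module.End.mul_apply, hm a b, map_zero])
    (fun a b m hm => sub_eq_zero.mp (hm a b)) (fun a b => hZ₁ (a, b)) hm₁ hnil₁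
  exact hm₂ (hker m₂ h₂)

/-- The vectors that are killed by all words of length `n` in the operators `X i`. -/
def wordKernel {ι : Type*} (X : ι → Module.End R M) : ℕ → Submodule R M
  | 0 => ⊥
  | n + 1 => ⨅ i, (wordKernel X n).comap (X i)

theorem mem_wordKernel_succ {ι : Type*} (X : ι → Module.End R M) (n : ℕ) (m : M) :
    m ∈ wordKernel X (n + 1) ↔ ∀ i, X i m ∈ wordKernel X n := by
  simp [wordKernel]

theorem wordKernel_mono {ι : Type*} (X : ι → Module.End R M) : Monotone (wordKernel X) := by
  refine monotone_nat_of_le_succ fun n => ?_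
  induction n with
  | zero => exact bot_le
  | succ n ih =>
    intro m hm
    rw [mem_wordKernel_succ] at hm ⊢
    exact fun i => ih (hm i)

/-- If all words of length `l.length + j` kill a vector, then all words of length `j` kill its image
under the word `l`. -/
theorem foldr_mem_wordKernel {ι : Type*} (X : ι → Module.End R M) (l : List ι) (j : ℕ) {m : M}
    (hm : m ∈ wordKernel X (l.length + j)) :
    l.foldr (fun i m => X i m) m ∈ wordKernel X j := by
  induction l generalizing j with
  | nil => simpa using hm
  | cons i l ih =>
    refine (mem_wordKernel_succ X j _).mp (ih (j + 1) ?_) i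
    rwa [List.length_cons, Nat.add_right_comm] at hm

/-- Finitely many operators with central commutators that are nilpotent at a vector are jointly
nilpotent there: all sufficiently long words kill it. The quotient by the vectors killed by all
sufficiently long words has no common kernel. -/
theorem exists_mem_wordKernel [CharZero R] {ι : Type*} [Finite ι]
    (X : ι → Module.End R M) (hX : ∀ a b c, Commute (X a * X b - X b * X a) (X c)) {m : M}
    (hm : ∀ i, ∃ n : ℕ, (X i ^ n) m = 0) : ∃ N, m ∈ wordKernel X N := by
  set W : Submodule R M := ⨆ n, wordKernel X n with hW
  have hmem : ∀ m, m ∈ W ↔ ∃ n, m ∈ wordKernel X n := fun m =>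
    Submodule.mem_iSup_of_directed _ (wordKernel_mono X).directed_le
  have hle : ∀ i, W ≤ W.comap (X i) := by
    intro i m hm
    obtain ⟨n, hn⟩ := (hmem m).mp hm
    exact (hmem _).mpr ⟨n, (mem_wordKernel_succ X n m).mp (wordKernel_mono X n.le_succ hn) i⟩
  have hpow : ∀ i (n : ℕ) (m : M),
      ((W.mapQ W (X i) (hle i)) ^ n) (W.mkQ m) = W.mkQ ((X i ^ n) m) := by
    intro i n
    induction n with
    | zero => intro m; simp
    | succ n ih =>
      intro m
      rw [pow_succ', Module.End.mul_apply, ih, pow_succ', Module.End.mul_apply]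
      rfl
  rw [← hmem, ← Submodule.Quotient.mk_eq_zero]
  refine eq_zero_of_forall_exists_pow_apply_eq_zero (fun i => W.mapQ W (X i) (hle i))
    (fun a b c => ?_) (fun q => ?_) (fun i => ?_)
  · refine LinearMap.ext fun q => ?_
    obtain ⟨m, rfl⟩ := W.mkQ_surjective q
    exact congrArg W.mkQ (LinearMap.congr_fun (hX a b c).eq m)
  · obtain ⟨m, rfl⟩ := W.mkQ_surjective q
    intro h
    have h1 : ∀ i, ∃ n, X i m ∈ wordKernel X n := fun i =>
      (hmem _).mp ((Submodule.Quotient.mk_eq_zero W).mp (h i))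
    choose n hn using h1
    cases nonempty_fintype ι
    refine (Submodule.Quotient.mk_eq_zero W).mpr ((hmem m).mpr ⟨Finset.univ.sup n + 1, ?_⟩)
    rw [mem_wordKernel_succ]
    exact fun i => wordKernel_mono X (Finset.le_sup (Finset.mem_univ i)) (hn i)
  · obtain ⟨n, hn⟩ := hm i
    exact ⟨n, by rw [← Submodule.mkQ_apply, hpow, hn, map_zero]⟩

end Module.End

/-! ### Finiteness of countable direct sums -/

open scoped DirectSum

namespace DirectSum

variable {K : Type*} [Semiring K] (W : ℕ → Type*) [∀ k, AddCommMonoid (W k)]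
  [∀ k, Module K (W k)]

theorem finite_of_eventually_eq_zero [∀ k, Module.Finite K (W k)] (N : ℕ)
    (h : ∀ k, N ≤ k → ∀ x : W k, x = 0) : Module.Finite K (⨁ k, W k) := by
  refine Module.Finite.of_surjective (∑ k : Fin N, (lof K ℕ W k) ∘ₗ
    (LinearMap.proj k : (∀ k : Fin N, W k) →ₗ[K] W k)) fun x => ⟨fun k => x k, ?_⟩
  refine DFinsupp.ext fun j => ?_
  rcases lt_or_ge j N with hj | hj
  · simp only [LinearMap.sum_apply, LinearMap.comp_apply, LinearMap.proj_apply]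
    rw [DirectSum.sum_apply, Finset.sum_eq_single ⟨j, hj⟩]
    · exact lof_apply K j (x j)
    · intro k _ hk
      exact of_eq_of_ne _ _ _ fun h => hk (Fin.ext h.symm)
    · simp
  · rw [h j hj (x j)]
    exact h j hj _

theorem exists_forall_eq_zero_of_finite [Module.Finite K (⨁ k, W k)] :
    ∃ N, ∀ k, N ≤ k → ∀ x : W k, x = 0 := by
  let S : ℕ → Submodule K (⨁ k, W k) := fun N =>
    ⨅ k : {k // N ≤ k}, LinearMap.ker (component K ℕ W k)
  have hS : ∀ N x, x ∈ S N ↔ ∀ k, N ≤ k → x k = 0 := by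
    intro N x
    simp only [S, Submodule.mem_iInf, LinearMap.mem_ker, Subtype.forall]
    rfl
  have hmono : Monotone S := fun M N hMN x hx =>
    (hS N x).mpr fun k hk => (hS M x).mp hx k (hMN.trans hk)
  have hex : ∀ x, ∃ N, x ∈ S N := by
    intro x
    induction x using DirectSum.induction_on with
    | zero => exact ⟨0, zero_mem _⟩
    | of i x =>
      exact ⟨i + 1, (hS _ _).mpr fun k hk => of_eq_of_ne _ _ _ (by omega)⟩
    | add x y hx hy =>
      obtain ⟨M, hM⟩ := hx
      obtain ⟨N, hN⟩ := hy
      exact ⟨max M N, add_mem (hmono (le_max_left M N) hM) (hmono (le_max_right M N) hN)⟩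
  obtain ⟨s, hs⟩ := Module.Finite.fg_top (R := K) (M := ⨁ k, W k)
  choose f hf using hex
  have htop : S (s.sup f) = ⊤ := top_le_iff.mp (hs ▸ Submodule.span_le.mpr fun x hx =>
    hmono (Finset.le_sup (f := f) hx) (hf x))
  refine ⟨s.sup f, fun k hk x => ?_⟩
  have h := (hS _ (lof K ℕ W k x)).mp (htop ▸ Submodule.mem_top) k hk
  rwa [lof_apply] at h

end DirectSum

/-! ### Stages of the Tanaka prolongation -/

namespace Tanaka

universe u

variable {K : Type*} {L : Type u} [Field K] [LieRing L] [LieAlgebra K L]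

/-- Membership in a homogeneous component, for a stage with one more component adjoined. -/
theorem Stage.mem_next_deg (gr : ℤ → Submodule K L) (P : Stage K L) (k : ℕ) (p : ℤ)
    (u : P.carrier × P.derivations gr k) :
    u ∈ (P.next gr k).deg p ↔ if p = k then u.1 = 0 else u.1 ∈ P.deg p ∧ u.2 = 0 := by
  by_cases hp : p = k
  · have h : (P.next gr k).deg p =
        LinearMap.range (LinearMap.inr K P.carrier (P.derivations gr k)) := if_pos hp
    rw [if_pos hp]
    refine ⟨fun hu => ?_, fun h1 => h.ge ⟨u.2, Prod.ext h1.symm rfl⟩⟩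
    obtain ⟨φ, rfl⟩ := h.le hu
    rfl
  · have h : (P.next gr k).deg p =
        (P.deg p).map (LinearMap.inl K P.carrier (P.derivations gr k)) := if_neg hp
    rw [if_neg hp]
    refine ⟨fun hu => ?_, fun h1 => h.ge ⟨u.1, h1.1, Prod.ext rfl h1.2.symm⟩⟩
    obtain ⟨v, hv, rfl⟩ := h.le hu
    exact ⟨hv, rfl⟩

/-- Every stage of the prolongation is a right module over the Lie algebra. -/
theorem stage_act_lie (gr : ℤ → Submodule K L) (k : ℕ) (u : (stage gr k).carrier) (x y : L) :
    (stage gr k).act u ⁅x, y⁆ =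
      (stage gr k).act ((stage gr k).act u x) y - (stage gr k).act ((stage gr k).act u y) x := by
  induction k with
  | zero =>
    have h (u : L) : ⁅u, ⁅x, y⁆⁆ = ⁅⁅u, x⁆, y⁆ - ⁅⁅u, y⁆, x⁆ := by
      rw [leibniz_lie, ← lie_skew ⁅u, y⁆ x, sub_neg_eq_add]
    exact h u
  | succ k ih =>
    obtain ⟨u, φ⟩ := u
    refine Prod.ext ?_ (sub_zero (0 : (stage gr k).derivations gr k)).symm
    change (stage gr k).act u ⁅x, y⁆ + φ.1 ⁅x, y⁆ =
      ((stage gr k).act ((stage gr k).act u x + φ.1 x) y + 0) -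
        ((stage gr k).act ((stage gr k).act u y + φ.1 y) x + 0)
    rw [ih, φ.2.2 x y]
    simp only [map_add, LinearMap.add_apply]
    abel

/-- The projection of `𝔤 ⊕ 𝔤₀ ⊕ ⋯ ⊕ 𝔤ₖ₋₁` onto `𝔤`. -/
def stageProj (gr : ℤ → Submodule K L) : (k : ℕ) → (stage gr k).carrier →ₗ[K] L
  | 0 => LinearMap.id
  | k + 1 => stageProj gr k ∘ₗ LinearMap.fst K (stage gr k).carrier (component gr k)

theorem stageProj_mem (gr : ℤ → Submodule K L) (k : ℕ) (p : ℤ)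
    (u : (stage gr k).carrier) (hu : u ∈ (stage gr k).deg p) : stageProj gr k u ∈ gr p := by
  induction k with
  | zero => exact hu
  | succ k ih =>
    have h := (Stage.mem_next_deg gr (stage gr k) k p u).mp hu
    change stageProj gr k u.1 ∈ gr p
    split_ifs at h with hp
    · rw [h, map_zero]
      exact zero_mem _
    · exact ih _ h.1

theorem stage_deg_eq_zero {gr : ℤ → Submodule K L} (hgr : ∀ p, 0 ≤ p → gr p = ⊥) (k : ℕ)
    {p : ℤ} (hp : k ≤ p) {u : (stage gr k).carrier} (hu : u ∈ (stage gr k).deg p) : u = 0 := by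
  induction k with
  | zero =>
    have hu' : u ∈ gr p := hu
    rw [hgr p (by simpa using hp)] at hu'
    exact (Submodule.mem_bot K).mp hu'
  | succ k ih =>
    have h := (Stage.mem_next_deg gr (stage gr k) k p u).mp hu
    push_cast at hp
    rw [if_neg (by omega)] at h
    exact Prod.ext (ih (by omega) h.1) h.2

theorem stage_act_mem_deg {gr : ℤ → Submodule K L} (hgr : ∀ p, 0 ≤ p → gr p = ⊥)
    (hbr : ∀ p, ∀ x ∈ gr p, ∀ y ∈ gr (-1), ⁅x, y⁆ ∈ gr (p - 1)) (k : ℕ) {p : ℤ}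
    {u : (stage gr k).carrier} (hu : u ∈ (stage gr k).deg p) {x : L} (hx : x ∈ gr (-1)) :
    (stage gr k).act u x ∈ (stage gr k).deg (p - 1) := by
  induction k with
  | zero => exact hbr p u hu x hx
  | succ k ih =>
    have h := (Stage.mem_next_deg gr (stage gr k) k p u).mp hu
    refine (Stage.mem_next_deg gr (stage gr k) k (p - 1) _).mpr ?_
    split_ifs at h with hp
    · rw [if_neg (by omega)]
      refine ⟨?_, rfl⟩
      change (stage gr k).act u.1 x + u.2.1 x ∈ _
      rw [h, map_zero, LinearMap.zero_apply, zero_add]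
      have h1 := u.2.2.1 (-1) x hx
      rwa [neg_add_eq_sub, ← hp] at h1
    · have h1 : (stage gr k).act u.1 x + u.2.1 x = (stage gr k).act u.1 x := by
        rw [h.2]
        exact add_zero _
      have h2 := ih h.1
      split_ifs with hp'
      · change (stage gr k).act u.1 x + u.2.1 x = 0
        rw [h1]
        exact stage_deg_eq_zero hgr k hp'.ge h2
      · exact ⟨by rw [← h1] at h2; exact h2, rfl⟩

/-- A linear map that sees only the components of degree at most `-2` of `𝔤` does not see the
elements `[φ, x]` with `φ` of degree at least `0` and `x` of degree `-1`. -/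
theorem apply_stageProj_act {gr : ℤ → Submodule K L} {F : Type*} [AddCommGroup F] [Module K F]
    (f : L →ₗ[K] F) (hf : ∀ p, -1 ≤ p → ∀ x ∈ gr p, f x = 0) (k : ℕ)
    (u : (stage gr k).carrier) {x : L} (hx : x ∈ gr (-1)) :
    f (stageProj gr k ((stage gr k).act u x)) = f ⁅stageProj gr k u, x⁆ := by
  induction k with
  | zero => rfl
  | succ k ih =>
    change f (stageProj gr k ((stage gr k).act u.1 x + u.2.1 x)) = f ⁅stageProj gr k u.1, x⁆
    rw [map_add, map_add, ih, hf (-1 + k) (by omega) _ (stageProj_mem gr k _ _ (u.2.2.1 _ x hx)),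
      add_zero]

theorem eq_zero_of_stageProj_eq_zero (gr : ℤ → Submodule K L) (k : ℕ) {p : ℤ} (hp : p < 0)
    {u : (stage gr k).carrier} (hu : u ∈ (stage gr k).deg p) (h0 : stageProj gr k u = 0) :
    u = 0 := by
  induction k with
  | zero => exact h0
  | succ k ih =>
    have h := (Stage.mem_next_deg gr (stage gr k) k p u).mp hu
    rw [if_neg (by omega)] at h
    exact Prod.ext (ih h.1 h0) h.2

/-- Transitivity of the prolongation, for a Lie algebra that is generated by its component of
degree `-1` (fundamental) and whose component of degree `-1` contains no nonzero central element
(nondegenerate): an element of degree at least `-1` that commutes with the component of degree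
`-1` vanishes. -/
theorem eq_zero_of_act_eq_zero {gr : ℤ → Submodule K L} (hgr : ∀ p, 0 ≤ p → gr p = ⊥)
    (hgen : gr (-1) ⊔ Submodule.span K {z | ∃ x ∈ gr (-1), ∃ y ∈ gr (-1), ⁅x, y⁆ = z} = ⊤)
    (hnd : ∀ x ∈ gr (-1), (∀ y ∈ gr (-1), ⁅x, y⁆ = 0) → x = 0) (k : ℕ) {p : ℤ} (hp : -1 ≤ p)
    {u : (stage gr k).carrier} (hu : u ∈ (stage gr k).deg p)
    (h0 : ∀ x ∈ gr (-1), (stage gr k).act u x = 0) : u = 0 := by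
  induction k with
  | zero =>
    have hu' : u ∈ gr p := hu
    rcases hp.eq_or_lt with rfl | hp
    · exact hnd u hu' h0
    · rw [hgr p (by omega)] at hu'
      exact (Submodule.mem_bot K).mp hu'
  | succ k ih =>
    have h := (Stage.mem_next_deg gr (stage gr k) k p u).mp hu
    have h1 : ∀ x ∈ gr (-1), (stage gr k).act u.1 x + u.2.1 x = 0 := fun x hx =>
      congrArg Prod.fst (h0 x hx)
    split_ifs at h with hp'
    · have h2 : ∀ x ∈ gr (-1), u.2.1 x = 0 := fun x hx => by
        have h3 := h1 x hx
        rwa [h, map_zero, LinearMap.zero_apply, zero_add] at h3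
      have hle : gr (-1) ⊔ Submodule.span K {z | ∃ x ∈ gr (-1), ∃ y ∈ gr (-1), ⁅x, y⁆ = z} ≤
          LinearMap.ker u.2.1 := by
        refine sup_le (fun x hx => h2 x hx) (Submodule.span_le.mpr ?_)
        rintro _ ⟨x, hx, y, hy, rfl⟩
        change u.2.1 ⁅x, y⁆ = 0
        rw [u.2.2.2, h2 x hx, h2 y hy]
        simp
      rw [hgen, top_le_iff, LinearMap.ker_eq_top] at hle
      exact Prod.ext h (Subtype.ext hle)
    · refine Prod.ext (ih h.1 fun x hx => ?_) h.2
      have h3 := h1 x hx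
      rw [h.2] at h3
      exact (add_zero _).symm.trans h3

theorem finiteDimensional_stage [FiniteDimensional K L] (gr : ℤ → Submodule K L) (k : ℕ) :
    FiniteDimensional K (stage gr k).carrier := by
  induction k with
  | zero => exact ‹FiniteDimensional K L›
  | succ k ih =>
    change FiniteDimensional K ((stage gr k).carrier × component gr k)
    infer_instance

theorem not_infiniteType_of_component_eq_bot [FiniteDimensional K L] {gr : ℤ → Submodule K L}
    (N : ℕ) (h : ∀ k, N ≤ k → component gr k = ⊥) : ¬ InfiniteType gr := by
  rw [InfiniteType, not_not]
  have hfin : ∀ k, Module.Finite K (component gr k) := fun k =>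
    have := finiteDimensional_stage gr k
    inferInstance
  have := DirectSum.finite_of_eventually_eq_zero (K := K) (fun k => component gr k) N
    fun k hk x => Subtype.ext ((Submodule.eq_bot_iff _).mp (h k hk) x.1 x.2)
  infer_instance

theorem infiniteType_of_component_ne_bot {gr : ℤ → Submodule K L}
    (h : ∀ k, component gr k ≠ ⊥) : InfiniteType gr := by
  intro hfin
  have : Module.Finite K (⨁ k : ℕ, component gr k) :=
    have : Module.Finite K (Prolongation gr) := hfin
    Module.Finite.of_surjective (LinearMap.snd K L (⨁ k : ℕ, component gr k))
      LinearMap.snd_surjective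
  obtain ⟨N, hN⟩ := DirectSum.exists_forall_eq_zero_of_finite (K := K) fun k => component gr k
  refine h N ((Submodule.eq_bot_iff _).mpr fun φ hφ => ?_)
  exact congrArg Subtype.val (hN N le_rfl ⟨φ, hφ⟩)

/-- Let `ω` be a nonzero linear functional that vanishes on the brackets and on all components but
that of degree `-1`, and `v ≠ 0` an element of degree `-1` with `[v, x] = ω(x) z` for a fixed `z`;
the latter is stated as the symmetry of `ω(y) [v, x]` in `x` and `y`. Then
`φ₀ = ω ⊗ v` and `φₖ₊₁ = ω ⊗ φₖ` are nonzero elements of the prolongation. -/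
theorem infiniteType_of_rank_one {gr : ℤ → Submodule K L}
    (ω : L →ₗ[K] K) (hω0 : ω ≠ 0) (hω : ∀ p, p ≠ -1 → ∀ x ∈ gr p, ω x = 0)
    (hωbr : ∀ x y : L, ω ⁅x, y⁆ = 0) {v : L} (hv : v ∈ gr (-1)) (hv0 : v ≠ 0)
    (hsymm : ∀ x y : L, ω y • ⁅v, x⁆ = ω x • ⁅v, y⁆) : InfiniteType gr := by
  have hmem : ∀ k, ∀ a ∈ (stage gr k).deg (k - 1),
      (∀ x y, ω y • (stage gr k).act a x = ω x • (stage gr k).act a y) →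
        ω.smulRight a ∈ component gr k := by
    intro k a ha hs
    refine ⟨fun p x hx => ?_, fun x y => ?_⟩
    · rw [LinearMap.smulRight_apply]
      by_cases hp : p = -1
      · rw [hp, neg_add_eq_sub]
        exact Submodule.smul_mem _ _ ha
      · rw [hω p hp x hx, zero_smul]
        exact zero_mem _
    · simp only [LinearMap.smulRight_apply, hωbr, zero_smul, map_smul, LinearMap.smul_apply]
      rw [hs y x, sub_self]
  have hne : ∀ k, ∀ a : (stage gr k).carrier, a ≠ 0 → ω.smulRight a ≠ 0 := by
    intro k a ha h
    refine hω0 (LinearMap.ext fun x => ?_)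
    exact (smul_eq_zero.mp (LinearMap.congr_fun h x)).resolve_right ha
  have key : ∀ k : ℕ, ∃ a ∈ (stage gr k).deg (k - 1), a ≠ 0 ∧
      ∀ x y, ω y • (stage gr k).act a x = ω x • (stage gr k).act a y := by
    intro k
    induction k with
    | zero =>
      refine ⟨v, ?_, hv0, hsymm⟩
      rw [Nat.cast_zero, zero_sub]
      exact hv
    | succ k ih =>
      obtain ⟨a, ha, ha0, hs⟩ := ih
      refine ⟨((0, ⟨ω.smulRight a, hmem k a ha hs⟩) : (stage gr k).carrier × component gr k),
        ?_, ?_, fun x y => ?_⟩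
      · refine (Stage.mem_next_deg gr (stage gr k) k _ _).mpr ?_
        rw [if_pos (by push_cast; ring)]
      · intro h
        exact hne k a ha0 (congrArg Subtype.val (congrArg Prod.snd h))
      · refine Prod.ext ?_ ?_
        · change ω y • ((stage gr k).act 0 x + ω x • a) = ω x • ((stage gr k).act 0 y + ω y • a)
          simp only [map_zero, LinearMap.zero_apply, zero_add]
          rw [smul_comm]
        · change ω y • (0 : component gr k) = ω x • (0 : component gr k)
          rw [smul_zero, smul_zero]
  refine infiniteType_of_component_ne_bot fun k hbot => ?_
  obtain ⟨a, ha, ha0, hs⟩ := key k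
  have h := hmem k a ha hs
  rw [hbot] at h
  exact hne k a ha0 ((Submodule.mem_bot K).mp h)

/-! ### The coaction on functionals and a criterion for finite type -/

/-- Families of linear functionals on all stages of the prolongation. Treating all stages at once
makes nilpotency bounds uniform in the stage. -/
abbrev StageDual (gr : ℤ → Submodule K L) : Type _ :=
  ∀ k, Module.Dual K (stage gr k).carrier

/-- The action of the Lie algebra on functionals that is dual to its right action on the stages:
`(x • m) u = m [u, x]`. -/
def coaction (gr : ℤ → Submodule K L) : L →ₗ[K] Module.End K (StageDual gr) where
  toFun x :=
    { toFun := fun m k => m k ∘ₗ (stage gr k).act.flip x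
      map_add' := fun _ _ => rfl
      map_smul' := fun _ _ => rfl }
  map_add' x y := by
    refine LinearMap.ext fun m => funext fun k => LinearMap.ext fun u => ?_
    change m k ((stage gr k).act u (x + y)) =
      m k ((stage gr k).act u x) + m k ((stage gr k).act u y)
    rw [map_add, map_add]
  map_smul' c x := by
    refine LinearMap.ext fun m => funext fun k => LinearMap.ext fun u => ?_
    change m k ((stage gr k).act u (c • x)) = c • m k ((stage gr k).act u x)
    rw [map_smul, map_smul]

theorem coaction_lie (gr : ℤ → Submodule K L) (x y : L) :
    coaction gr ⁅x, y⁆ = coaction gr x * coaction gr y - coaction gr y * coaction gr x := by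
  refine LinearMap.ext fun m => funext fun k => LinearMap.ext fun u => ?_
  change m k ((stage gr k).act u ⁅x, y⁆) = m k ((stage gr k).act ((stage gr k).act u x) y) -
    m k ((stage gr k).act ((stage gr k).act u y) x)
  rw [stage_act_lie, map_sub]

theorem commute_coaction {gr : ℤ → Submodule K L} {x y : L} (h : ⁅x, y⁆ = 0) :
    Commute (coaction gr x) (coaction gr y) := by
  have h1 := coaction_lie gr x y
  rw [h, map_zero] at h1
  exact (sub_eq_zero.mp h1.symm)

/-- The functionals on the stages that are induced by a functional on the Lie algebra itself. -/
def inducedDual (gr : ℤ → Submodule K L) (f : Module.Dual K L) : StageDual gr :=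
  fun k => f ∘ₗ stageProj gr k

/-- If a functional `f` kills the components of degree at least `-1`, then `x • f` is induced by
`f [·, x]` for every `x` of degree `-1`. -/
theorem coaction_inducedDual {gr : ℤ → Submodule K L} (f g : Module.Dual K L)
    (hf : ∀ p, -1 ≤ p → ∀ x ∈ gr p, f x = 0) {x : L} (hx : x ∈ gr (-1))
    (hg : ∀ y, f ⁅y, x⁆ = g y) : coaction gr x (inducedDual gr f) = inducedDual gr g :=
  funext fun k => LinearMap.ext fun u =>
    (apply_stageProj_act f hf k u hx).trans (hg (stageProj gr k u))

/-- An element of degree `n - 2` of the prolongation is detected by bracketing it `n` times with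
elements of degree `-1` and applying functionals that separate the component of degree `-2`. -/
theorem exists_foldr_coaction_ne_zero {gr : ℤ → Submodule K L}
    (hgr : ∀ p, 0 ≤ p → gr p = ⊥)
    (hbr : ∀ p, ∀ x ∈ gr p, ∀ y ∈ gr (-1), ⁅x, y⁆ ∈ gr (p - 1))
    (hgen : gr (-1) ⊔ Submodule.span K {z | ∃ x ∈ gr (-1), ∃ y ∈ gr (-1), ⁅x, y⁆ = z} = ⊤)
    (hnd : ∀ x ∈ gr (-1), (∀ y ∈ gr (-1), ⁅x, y⁆ = 0) → x = 0)
    {ι κ : Type*} (b : ι → L) (hb : Submodule.span K (Set.range b) = gr (-1))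
    (f : κ → Module.Dual K L) (hf : ∀ x ∈ gr (-2), (∀ e, f e x = 0) → x = 0) (k n : ℕ)
    {u : (stage gr k).carrier} (hu : u ∈ (stage gr k).deg (n - 2)) (hu0 : u ≠ 0) :
    ∃ l : List ι, l.length = n ∧ ∃ e,
      l.foldr (fun i m => coaction gr (b i) m) (inducedDual gr (f e)) k u ≠ 0 := by
  induction n generalizing u with
  | zero =>
    rw [Nat.cast_zero, zero_sub] at hu
    refine ⟨[], rfl, ?_⟩
    by_contra! h
    exact hu0 (eq_zero_of_stageProj_eq_zero gr k (by norm_num) hu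
      (hf _ (stageProj_mem gr k _ u hu) h))
  | succ n ih =>
    obtain ⟨i, hi⟩ : ∃ i, (stage gr k).act u (b i) ≠ 0 := by
      by_contra! h
      refine hu0 (eq_zero_of_act_eq_zero hgr hgen hnd k (by push_cast; omega) hu ?_)
      have hle : gr (-1) ≤ LinearMap.ker ((stage gr k).act u) := by
        rw [← hb, Submodule.span_le]
        rintro _ ⟨i, rfl⟩
        exact h i
      exact hle
    have hbi : b i ∈ gr (-1) := hb ▸ Submodule.subset_span ⟨i, rfl⟩
    have hdeg := stage_act_mem_deg hgr hbr k hu hbi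
    rw [show ((n + 1 : ℕ) : ℤ) - 2 - 1 = n - 2 by push_cast; ring] at hdeg
    obtain ⟨l, hl, e, he⟩ := ih hdeg hi
    exact ⟨i :: l, by rw [List.length_cons, hl], e, he⟩

/-- A fundamental nondegenerate Lie algebra with central brackets is of finite type as soon as every
vector of a finite family spanning `𝔤₋₁` acts nilpotently on each functional of a finite family
that separates the points of `𝔤₋₂`. -/
theorem not_infiniteType_of_coaction_pow_eq_zero [CharZero K] [FiniteDimensional K L]
    {gr : ℤ → Submodule K L} (hgr : ∀ p, 0 ≤ p → gr p = ⊥)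
    (hbr : ∀ p, ∀ x ∈ gr p, ∀ y ∈ gr (-1), ⁅x, y⁆ ∈ gr (p - 1))
    (hgen : gr (-1) ⊔ Submodule.span K {z | ∃ x ∈ gr (-1), ∃ y ∈ gr (-1), ⁅x, y⁆ = z} = ⊤)
    (hnd : ∀ x ∈ gr (-1), (∀ y ∈ gr (-1), ⁅x, y⁆ = 0) → x = 0)
    (hnil : ∀ x y z : L, ⁅⁅x, y⁆, z⁆ = 0)
    {ι κ : Type*} [Finite ι] [Finite κ] (b : ι → L)
    (hb : Submodule.span K (Set.range b) = gr (-1))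
    (f : κ → Module.Dual K L) (hf : ∀ x ∈ gr (-2), (∀ e, f e x = 0) → x = 0)
    (hpow : ∀ e i, ∃ n : ℕ, (coaction gr (b i) ^ n) (inducedDual gr (f e)) = 0) :
    ¬ InfiniteType gr := by
  have hX : ∀ i j l, Commute
      (coaction gr (b i) * coaction gr (b j) - coaction gr (b j) * coaction gr (b i))
      (coaction gr (b l)) := by
    intro i j l
    rw [← coaction_lie]
    exact commute_coaction (hnil _ _ _)
  choose N hN using fun e => Module.End.exists_mem_wordKernel
    (fun i => coaction gr (b i)) hX (hpow e)
  cases nonempty_fintype κ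
  refine not_infiniteType_of_component_eq_bot (Finset.univ.sup N) fun k hk => ?_
  refine (Submodule.eq_bot_iff _).mpr fun φ hφ => ?_
  by_contra hφ0
  -- View `φ` as an element of degree `k` of the next stage.
  let u : (stage gr k).carrier × component gr k := (0, ⟨φ, hφ⟩)
  have hu : u ∈ (stage gr (k + 1)).deg ((k + 2 : ℕ) - 2) := by
    refine (Stage.mem_next_deg gr (stage gr k) k _ _).mpr ?_
    rw [if_pos (by push_cast; ring)]
  have hu0 : u ≠ 0 := fun h => hφ0 (congrArg Subtype.val (congrArg Prod.snd h))
  obtain ⟨l, hl, e, he⟩ :=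
    exists_foldr_coaction_ne_zero hgr hbr hgen hnd b hb f hf (k + 1) (k + 2) hu hu0
  have hmem : inducedDual gr (f e) ∈
      Module.End.wordKernel (fun i => coaction gr (b i)) (l.length + 0) := by
    refine Module.End.wordKernel_mono _ ?_ (hN e)
    have := Finset.le_sup (f := N) (Finset.mem_univ e)
    omega
  have h0 := (Submodule.mem_bot K).mp (Module.End.foldr_mem_wordKernel _ l 0 hmem)
  exact he (by rw [h0]; rfl)

end Tanaka

/-! ### The structure of a graph Lie algebra -/

namespace LabeledDigraph

variable {V C : Type*}

theorem UniquelyLabeled.vertexBracket_label [DecidableEq V] {G : LabeledDigraph V C}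
    (hG : G.UniquelyLabeled) {a b : V} (h : G.Adj a b) (v w : V) :
    G.vertexBracket v w (G.label ⟨(a, b), h⟩) =
      if v = a ∧ w = b then 1 else if v = b ∧ w = a then -1 else 0 := by
  classical
  have hsingle : ∀ (v w : V) (h' : G.Adj v w),
      (Pi.single (M := fun _ => ℝ) (G.label ⟨(v, w), h'⟩) 1 : C → ℝ) (G.label ⟨(a, b), h⟩) =
        if v = a ∧ w = b then 1 else 0 := by
    intro v w h'
    rw [Pi.single_apply]
    refine if_congr ⟨fun h1 => ?_, ?_⟩ rfl rfl
    · have h2 := congrArg Subtype.val (hG h1)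
      exact ⟨(congrArg Prod.fst h2).symm, (congrArg Prod.snd h2).symm⟩
    · rintro ⟨rfl, rfl⟩
      rfl
  by_cases h1 : G.Adj v w
  · have h2 : ¬(v = b ∧ w = a) := by
      rintro ⟨rfl, rfl⟩
      exact G.asymm _ _ h h1
    rw [vertexBracket, dif_pos h1, if_neg h2]
    convert hsingle v w h1
  · have h2 : ¬(v = a ∧ w = b) := by
      rintro ⟨rfl, rfl⟩
      exact h1 h
    rw [vertexBracket, dif_neg h1, if_neg h2]
    by_cases h3 : G.Adj w v
    · rw [dif_pos h3, Pi.neg_apply]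
      have h4 := congrArg Neg.neg (hsingle w v h3)
      rw [neg_ite, neg_zero, if_congr and_comm rfl rfl] at h4
      convert h4
    · have h4 : ¬(v = b ∧ w = a) := by
        rintro ⟨rfl, rfl⟩
        exact h3 h
      rw [dif_neg h3, if_neg h4, Pi.zero_apply]

theorem exists_adj_of_degree_ne_zero {G : LabeledDigraph V C} {v : V} (h : G.degree v ≠ 0) :
    ∃ w, G.Adj v w ∨ G.Adj w v :=
  Set.nonempty_of_ncard_ne_zero h

namespace LieAlg

variable (G : LabeledDigraph V C)

theorem mem_grading_neg_one (x : G.LieAlg) : x ∈ grading G (-1) ↔ x.2 = 0 := by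
  have h : grading G (-1) = LinearMap.range (LinearMap.inl ℝ (V → ℝ) (C → ℝ)) := if_pos rfl
  refine ⟨fun hx => ?_, fun hx => h.ge ⟨x.1, Prod.ext rfl hx.symm⟩⟩
  obtain ⟨y, rfl⟩ := h.le hx
  rfl

theorem mem_grading_neg_two (x : G.LieAlg) : x ∈ grading G (-2) ↔ x.1 = 0 := by
  have h : grading G (-2) = LinearMap.range (LinearMap.inr ℝ (V → ℝ) (C → ℝ)) := by
    unfold grading
    rw [if_neg (by norm_num), if_pos rfl]
    rfl
  refine ⟨fun hx => ?_, fun hx => h.ge ⟨x.2, Prod.ext hx.symm rfl⟩⟩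
  obtain ⟨y, rfl⟩ := h.le hx
  rfl

theorem grading_eq_bot {p : ℤ} (h1 : p ≠ -1) (h2 : p ≠ -2) : grading G p = ⊥ := by
  unfold grading
  rw [if_neg h1, if_neg h2]

theorem vertex_mem_grading (v : V) : vertex G v ∈ grading G (-1) :=
  (mem_grading_neg_one G _).mpr rfl

theorem vertex_fst [DecidableEq V] (v w : V) : (vertex G v).1 w = if w = v then 1 else 0 := by
  classical
  refine Eq.trans ?_ (Pi.single_apply v (1 : ℝ) w)
  unfold vertex
  congr!

/-- The coordinate of an element of a graph Lie algebra at a vertex. -/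
def vertexCoord (v : V) : Module.Dual ℝ G.LieAlg where
  toFun x := x.1 v
  map_add' _ _ := rfl
  map_smul' _ _ := rfl

/-- The coordinate of an element of a graph Lie algebra at a label. -/
def labelCoord (e : C) : Module.Dual ℝ G.LieAlg where
  toFun x := x.2 e
  map_add' _ _ := rfl
  map_smul' _ _ := rfl

variable {G} in
theorem ext_coord {x y : G.LieAlg} (h1 : ∀ v, vertexCoord G v x = vertexCoord G v y)
    (h2 : ∀ e, labelCoord G e x = labelCoord G e y) : x = y :=
  Prod.ext (funext h1) (funext h2)

theorem labelCoord_eq_zero (e : C) (p : ℤ) (hp : -1 ≤ p) (x : G.LieAlg) (hx : x ∈ grading G p) :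
    labelCoord G e x = 0 := by
  rcases hp.eq_or_lt with rfl | hp
  · exact congrFun ((mem_grading_neg_one G x).mp hx) e
  · rw [grading_eq_bot G (by omega) (by omega)] at hx
    rw [(Submodule.mem_bot ℝ).mp hx, map_zero]

instance [Finite V] [Finite C] : FiniteDimensional ℝ G.LieAlg :=
  inferInstanceAs (FiniteDimensional ℝ ((V → ℝ) × (C → ℝ)))

variable [Fintype V]

theorem lie_vertex_snd (x : G.LieAlg) (w : V) :
    (⁅x, vertex G w⁆ : G.LieAlg).2 = ∑ v, x.1 v • G.vertexBracket v w := by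
  classical
  change ∑ v, ∑ u, (x.1 v * (vertex G w).1 u) • G.vertexBracket v u = _
  simp [vertex_fst]

theorem vertex_lie_snd (v : V) (x : G.LieAlg) :
    (⁅vertex G v, x⁆ : G.LieAlg).2 = ∑ w, x.1 w • G.vertexBracket v w := by
  classical
  change ∑ u, ∑ w, ((vertex G v).1 u * x.1 w) • G.vertexBracket u w = _
  simp [vertex_fst]

theorem lie_eq_zero_of_fst_eq_zero {x : G.LieAlg} (hx : x.1 = 0) (y : G.LieAlg) : ⁅x, y⁆ = 0 := by
  refine Prod.ext rfl ?_
  change ∑ v, ∑ w, (x.1 v * y.1 w) • G.vertexBracket v w = 0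
  simp [hx]

theorem lie_lie_eq_zero (x y z : G.LieAlg) : ⁅⁅x, y⁆, z⁆ = 0 :=
  lie_eq_zero_of_fst_eq_zero G rfl z

theorem lie_mem_grading (p : ℤ) (x : G.LieAlg) (hx : x ∈ grading G p) (y : G.LieAlg)
    (_hy : y ∈ grading G (-1)) : ⁅x, y⁆ ∈ grading G (p - 1) := by
  by_cases h1 : p = -1
  · subst h1
    exact (mem_grading_neg_two G _).mpr rfl
  · suffices hx0 : x.1 = 0 by
      rw [lie_eq_zero_of_fst_eq_zero G hx0]
      exact zero_mem _
    by_cases h2 : p = -2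
    · subst h2
      exact (mem_grading_neg_two G x).mp hx
    · rw [grading_eq_bot G h1 h2] at hx
      rw [(Submodule.mem_bot ℝ).mp hx]
      rfl

theorem span_vertex : Submodule.span ℝ (Set.range (vertex G)) = grading G (-1) := by
  classical
  refine le_antisymm (Submodule.span_le.mpr ?_) fun x hx => ?_
  · rintro _ ⟨v, rfl⟩
    exact vertex_mem_grading G v
  · have h : x = ∑ v, x.1 v • vertex G v := by
      refine Prod.ext (funext fun w => ?_) ?_
      · change vertexCoord G w x = vertexCoord G w (∑ v, x.1 v • vertex G v)
        rw [map_sum, Finset.sum_eq_single w]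
        · change x.1 w = x.1 w * (vertex G w).1 w
          rw [vertex_fst, if_pos rfl, mul_one]
        · intro v _ hv
          change x.1 v * (vertex G v).1 w = 0
          rw [vertex_fst, if_neg hv.symm, mul_zero]
        · simp
      · rw [(mem_grading_neg_one G x).mp hx]
        exact ((mem_grading_neg_one G _).mp (sum_mem fun v _ =>
          Submodule.smul_mem _ _ (vertex_mem_grading G v))).symm
    rw [h]
    exact sum_mem fun v _ => Submodule.smul_mem _ _ (Submodule.subset_span ⟨v, rfl⟩)

/-- A graph Lie algebra is generated by its vertices, since every label occurs on an edge. -/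
theorem grading_sup_span_lie [Fintype C] :
    grading G (-1) ⊔ Submodule.span ℝ
      {z | ∃ x ∈ grading G (-1), ∃ y ∈ grading G (-1), ⁅x, y⁆ = z} = ⊤ := by
  classical
  refine top_le_iff.mp fun x _ => ?_
  let p : G.LieAlg := (x.1, 0)
  let s : C → G.LieAlg := fun e => (0, Pi.single e 1)
  have hs : ∀ e e', labelCoord G e (s e') = if e = e' then 1 else 0 := fun e e' =>
    Pi.single_apply e' (1 : ℝ) e
  have h : x = p + ∑ e, labelCoord G e x • s e := by
    refine ext_coord (fun w => ?_) fun e => ?_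
    · have hp : vertexCoord G w p = vertexCoord G w x := rfl
      have hs0 : ∀ e, vertexCoord G w (s e) = 0 := fun _ => rfl
      simp [map_sum, hp, hs0]
    · have hp : labelCoord G e p = 0 := rfl
      simp [map_sum, hp, hs]
  rw [h]
  refine add_mem (Submodule.mem_sup_left ((mem_grading_neg_one G _).mpr rfl))
    (Submodule.mem_sup_right (sum_mem fun e _ => Submodule.smul_mem _ _ ?_))
  obtain ⟨⟨⟨a, b⟩, hab⟩, rfl⟩ := G.label_surjective e
  refine Submodule.subset_span
    ⟨vertex G a, vertex_mem_grading G a, vertex G b, vertex_mem_grading G b, ?_⟩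
  refine Prod.ext rfl ?_
  rw [lie_vertex_snd, Finset.sum_eq_single a]
  · rw [vertex_fst, if_pos rfl, one_smul, vertexBracket, dif_pos hab]
  · intro v _ hv
    rw [vertex_fst, if_neg hv, zero_smul]
  · simp

end LieAlg

open LieAlg

variable [Fintype V] {G : LabeledDigraph V C}

theorem UniquelyLabeled.lie_vertex_label [DecidableEq V] (hG : G.UniquelyLabeled) {a b : V}
    (h : G.Adj a b) (y : G.LieAlg) (c : V) :
    labelCoord G (G.label ⟨(a, b), h⟩) ⁅y, vertex G c⁆ =
      if c = b then y.1 a else if c = a then -y.1 b else 0 := by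
  change (⁅y, vertex G c⁆ : G.LieAlg).2 _ = _
  have hab : a ≠ b := by
    rintro rfl
    exact G.asymm _ _ h h
  rw [lie_vertex_snd, Finset.sum_apply]
  simp only [Pi.smul_apply, hG.vertexBracket_label h, smul_eq_mul]
  split_ifs with h1 h2
  · subst h1
    rw [Finset.sum_eq_single a] <;> simp +contextual [hab.symm]
  · subst h2
    rw [Finset.sum_eq_single b] <;> simp +contextual [hab]
  · simp [h1, h2]

/-- For adjacent vertices `a` and `b`, the coordinate at the label of their edge, with the sign
that makes `[a, b]` positive. -/
theorem UniquelyLabeled.exists_edgeCoord (hG : G.UniquelyLabeled) {a b : V}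
    (h : G.Adj a b ∨ G.Adj b a) : ∃ g : Module.Dual ℝ G.LieAlg,
      (∀ p, -1 ≤ p → ∀ x ∈ grading G p, g x = 0) ∧
      (∀ y : G.LieAlg, g ⁅y, vertex G b⁆ = vertexCoord G a y) ∧
      ∀ c, c ≠ a → c ≠ b → ∀ y : G.LieAlg, g ⁅y, vertex G c⁆ = 0 := by
  classical
  rcases h with h | h
  · refine ⟨_, labelCoord_eq_zero G (G.label ⟨(a, b), h⟩), fun y => ?_, fun c h1 h2 y => ?_⟩
    · rw [hG.lie_vertex_label, if_pos rfl]
      rfl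
    · rw [hG.lie_vertex_label, if_neg h2, if_neg h1]
  · have hab : a ≠ b := by
      rintro rfl
      exact G.asymm _ _ h h
    refine ⟨-labelCoord G (G.label ⟨(b, a), h⟩), fun p hp x hx => ?_, fun y => ?_,
      fun c h1 h2 y => ?_⟩
    · rw [LinearMap.neg_apply, labelCoord_eq_zero G _ p hp x hx, neg_zero]
    · rw [LinearMap.neg_apply, hG.lie_vertex_label, if_neg hab.symm, if_pos rfl, neg_neg]
      rfl
    · rw [LinearMap.neg_apply, hG.lie_vertex_label, if_neg h1, if_neg h2, neg_zero]

theorem exists_adj_ne {v : V} (h0 : G.degree v ≠ 0) (h1 : G.degree v ≠ 1) (c : V) :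
    ∃ w, (G.Adj v w ∨ G.Adj w v) ∧ w ≠ c := by
  by_contra! h
  have hle : G.degree v ≤ ({c} : Set V).ncard :=
    Set.ncard_le_ncard (fun w hw => h w hw) (Set.toFinite _)
  rw [Set.ncard_singleton] at hle
  omega

/-- A graph Lie algebra without isolated vertices is nondegenerate. -/
theorem UniquelyLabeled.eq_zero_of_lie_eq_zero (hG : G.UniquelyLabeled)
    (h0 : ∀ v, G.degree v ≠ 0) (x : G.LieAlg) (hx : x ∈ grading G (-1))
    (h : ∀ y ∈ grading G (-1), ⁅x, y⁆ = 0) : x = 0 := by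
  refine Prod.ext (funext fun v => ?_) ((mem_grading_neg_one G x).mp hx)
  obtain ⟨w, hw⟩ := exists_adj_of_degree_ne_zero (h0 v)
  obtain ⟨g, -, hg, -⟩ := hG.exists_edgeCoord hw
  have h1 := hg x
  rw [h _ (vertex_mem_grading G w), map_zero] at h1
  exact h1.symm

/-! ### Dimension of the kernel of a vertex -/

theorem UniquelyLabeled.mem_ker_ad_vertex (hG : G.UniquelyLabeled) (v : V) (x : G.LieAlg) :
    x ∈ (LieAlgebra.ad ℝ G.LieAlg (vertex G v)).ker ↔
      ∀ w, (G.Adj v w ∨ G.Adj w v) → x.1 w = 0 := by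
  classical
  rw [LinearMap.mem_ker, LieAlgebra.ad_apply]
  constructor
  · intro h w hw
    obtain ⟨g, -, hg, -⟩ := hG.exists_edgeCoord hw.symm
    have h1 := hg x
    rw [← lie_skew, h, neg_zero, map_zero] at h1
    exact h1.symm
  · intro h
    refine Prod.ext rfl ?_
    rw [vertex_lie_snd]
    refine Finset.sum_eq_zero fun w _ => ?_
    by_cases hw : G.Adj v w ∨ G.Adj w v
    · rw [h w hw, zero_smul]
    · rw [not_or] at hw
      rw [vertexBracket, dif_neg hw.1, dif_neg hw.2, smul_zero]

theorem UniquelyLabeled.finrank_ker_ad_vertex [Fintype C] (hG : G.UniquelyLabeled) (v : V) :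
    (Module.finrank ℝ ↥((LieAlgebra.ad ℝ G.LieAlg (vertex G v)).ker ⊓ grading G (-1)) : ℤ) =
      (Fintype.card V : ℤ) - (G.degree v : ℤ) := by
  classical
  let N : Set V := {w : V | G.Adj v w ∨ G.Adj w v}
  let r : (V → ℝ) →ₗ[ℝ] (N → ℝ) := LinearMap.funLeft ℝ ℝ Subtype.val
  let i : (V → ℝ) →ₗ[ℝ] G.LieAlg := LinearMap.inl ℝ (V → ℝ) (C → ℝ)
  have hi : Function.Injective i := LinearMap.inl_injective
  have hr : Function.Surjective r :=
    LinearMap.funLeft_surjective_of_injective ℝ ℝ _ Subtype.val_injective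
  have hker : (LieAlgebra.ad ℝ G.LieAlg (vertex G v)).ker ⊓ grading G (-1) =
      (LinearMap.ker r).map i := by
    ext x
    rw [Submodule.mem_inf, hG.mem_ker_ad_vertex, mem_grading_neg_one, Submodule.mem_map]
    constructor
    · rintro ⟨h1, h2⟩
      exact ⟨x.1, funext fun w => h1 w.1 w.2, Prod.ext rfl h2.symm⟩
    · rintro ⟨y, hy, rfl⟩
      exact ⟨fun w hw => congrFun hy ⟨w, hw⟩, rfl⟩
  have h1 := LinearMap.finrank_range_add_finrank_ker r
  rw [LinearMap.range_eq_top.mpr hr, finrank_top, Module.finrank_fintype_fun_eq_card,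
    Module.finrank_fintype_fun_eq_card, ← Nat.card_eq_fintype_card,
    Nat.card_coe_set_eq] at h1
  rw [hker, ← (Submodule.equivMapOfInjective i hi (LinearMap.ker r)).finrank_eq, ← h1]
  change _ = ((N.ncard + _ : ℕ) : ℤ) - (N.ncard : ℤ)
  push_cast
  ring

/-! ### Infinite type -/

open Tanaka in
theorem infiniteType_of_degree_eq_one [Fintype C] {v : V} (hv : G.degree v = 1) :
    InfiniteType (grading G) := by
  classical
  obtain ⟨w, hw⟩ := Set.ncard_eq_one.mp hv
  have hbr : ∀ x : G.LieAlg, (⁅vertex G v, x⁆ : G.LieAlg).2 = x.1 w • G.vertexBracket v w := by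
    intro x
    rw [vertex_lie_snd, Finset.sum_eq_single w]
    · intro u _ hu
      have h : u ∉ {w : V | G.Adj v w ∨ G.Adj w v} := by rwa [hw]
      rw [Set.mem_ofPred_eq, not_or] at h
      rw [vertexBracket, dif_neg h.1, dif_neg h.2, smul_zero]
    · simp
  refine infiniteType_of_rank_one (vertexCoord G w) ?_ ?_ (fun _ _ => rfl)
    (vertex_mem_grading G v) ?_ fun x y => Prod.ext ?_ ?_
  · intro h
    have h1 : (vertex G w).1 w = 0 := LinearMap.congr_fun h (vertex G w)
    rw [vertex_fst, if_pos rfl] at h1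
    exact one_ne_zero h1
  · intro p hp x hx
    by_cases h2 : p = -2
    · subst h2
      exact congrFun ((mem_grading_neg_two G x).mp hx) w
    · rw [grading_eq_bot G hp h2] at hx
      rw [(Submodule.mem_bot ℝ).mp hx, map_zero]
  · intro h
    have h1 : (vertex G v).1 v = 0 := congrFun (congrArg Prod.fst h) v
    rw [vertex_fst, if_pos rfl] at h1
    exact one_ne_zero h1
  · change y.1 w • (0 : V → ℝ) = x.1 w • (0 : V → ℝ)
    rw [smul_zero, smul_zero]
  · change y.1 w • (⁅vertex G v, x⁆ : G.LieAlg).2 = x.1 w • (⁅vertex G v, y⁆ : G.LieAlg).2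
    rw [hbr, hbr, smul_comm]

/-! ### Finite type -/

open Tanaka

/-- If `b` has a neighbour `d ≠ c`, then the coordinate at `b` is `d • g` for the coordinate `g` of
the edge `bd`. As `c` kills `g` and the commutator of `c` and `d` is central, `c² d g = 0`. -/
theorem UniquelyLabeled.coaction_vertex_sq (hG : G.UniquelyLabeled) {b : V}
    (h0 : G.degree b ≠ 0) (h1 : G.degree b ≠ 1) {c : V} (hcb : c ≠ b) :
    coaction (grading G) (vertex G c) (coaction (grading G) (vertex G c)
      (inducedDual (grading G) (vertexCoord G b))) = 0 := by
  obtain ⟨d, hd, hdc⟩ := exists_adj_ne h0 h1 c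
  obtain ⟨g, hg, hgd, hgc⟩ := hG.exists_edgeCoord hd
  have hd1 := coaction_inducedDual g _ hg (vertex_mem_grading G d) hgd
  have hc1 := coaction_inducedDual g 0 hg (vertex_mem_grading G c) (hgc c hcb hdc.symm)
  have hzero : inducedDual (grading G) (0 : Module.Dual ℝ G.LieAlg) = 0 := rfl
  rw [hzero] at hc1
  have hlie := LinearMap.congr_fun (coaction_lie (grading G) (vertex G c) (vertex G d))
    (inducedDual (grading G) g)
  rw [LinearMap.sub_apply, Module.End.mul_apply, Module.End.mul_apply, hc1, map_zero, sub_zero,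
    hd1] at hlie
  rw [← hlie, ← Module.End.mul_apply,
    ← (commute_coaction (lie_lie_eq_zero G (vertex G c) (vertex G d) (vertex G c))).eq,
    Module.End.mul_apply, hc1, map_zero]

theorem UniquelyLabeled.coaction_vertex_cube (hG : G.UniquelyLabeled)
    (h0 : ∀ v, G.degree v ≠ 0) (h1 : ∀ v, G.degree v ≠ 1) (e : C) (c : V) :
    (coaction (grading G) (vertex G c) ^ 3) (inducedDual (grading G) (labelCoord G e)) = 0 := by
  classical
  obtain ⟨⟨⟨a, b⟩, hab⟩, rfl⟩ := G.label_surjective e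
  have hne : a ≠ b := by
    rintro rfl
    exact G.asymm _ _ hab hab
  rw [pow_succ, Module.End.mul_apply, pow_two, Module.End.mul_apply]
  have hlab := labelCoord_eq_zero G (G.label ⟨(a, b), hab⟩)
  have hc := vertex_mem_grading G c
  by_cases hcb : c = b
  · subst hcb
    rw [coaction_inducedDual _ (vertexCoord G a) hlab hc fun y => by
      rw [hG.lie_vertex_label, if_pos rfl]; rfl]
    exact hG.coaction_vertex_sq (h0 a) (h1 a) hne.symm
  · by_cases hca : c = a
    · subst hca
      rw [coaction_inducedDual _ (-vertexCoord G b) hlab hc fun y => by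
        rw [hG.lie_vertex_label, if_neg hcb, if_pos rfl]; rfl]
      have hneg : inducedDual (grading G) (-vertexCoord G b) =
          -inducedDual (grading G) (vertexCoord G b) := rfl
      rw [hneg, map_neg, map_neg, hG.coaction_vertex_sq (h0 b) (h1 b) hne, neg_zero]
    · rw [coaction_inducedDual _ 0 hlab hc fun y => by
        rw [hG.lie_vertex_label, if_neg hcb, if_neg hca]; rfl]
      have hzero : inducedDual (grading G) (0 : Module.Dual ℝ G.LieAlg) = 0 := rfl
      rw [hzero, map_zero, map_zero]

theorem UniquelyLabeled.not_infiniteType [Fintype C] (hG : G.UniquelyLabeled)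
    (h0 : ∀ v, G.degree v ≠ 0) (h1 : ∀ v, G.degree v ≠ 1) : ¬ InfiniteType (grading G) :=
  not_infiniteType_of_coaction_pow_eq_zero
    (fun _ hp => grading_eq_bot G (by omega) (by omega)) (lie_mem_grading G)
    (grading_sup_span_lie G) (hG.eq_zero_of_lie_eq_zero h0) (lie_lie_eq_zero G) (vertex G)
    (span_vertex G) (labelCoord G)
    (fun x hx h => Prod.ext ((mem_grading_neg_two G x).mp hx) (funext h))
    fun e c => ⟨3, hG.coaction_vertex_cube h0 h1 e c⟩

end LabeledDigraph

theorem mainTheorem1 {V C : Type*} [Fintype V] [Fintype C] (G : LabeledDigraph V C)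
    (hG : G.UniquelyLabeled) :
    (∀ v : V,
      (Module.finrank ℝ ↥((LieAlgebra.ad ℝ G.LieAlg (LabeledDigraph.LieAlg.vertex G v)).ker ⊓
          LabeledDigraph.LieAlg.grading G (-1)) : ℤ) =
        (Fintype.card V : ℤ) - (G.degree v : ℤ)) ∧
    ((∃ v : V, G.degree v = 1) →
      Tanaka.InfiniteType (LabeledDigraph.LieAlg.grading G)) ∧
    ((∀ v : V, G.degree v ≠ 0) →
      (Tanaka.InfiniteType (LabeledDigraph.LieAlg.grading G) ↔ ∃ v : V, G.degree v = 1)) := by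
  have hinf : (∃ v : V, G.degree v = 1) →
      Tanaka.InfiniteType (LabeledDigraph.LieAlg.grading G) := fun ⟨_, hv⟩ =>
    LabeledDigraph.infiniteType_of_degree_eq_one hv
  refine ⟨hG.finrank_ker_ad_vertex, hinf, fun h0 => ⟨fun h => ?_, hinf⟩⟩
  by_contra! h1
  exact hG.not_infiniteType h0 h1 h
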